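/- Let $R\ge 2$ be an integer, let $\phi\in C^2(0,\infty)$ and $F>0$, and write $\phi''_{rF}=\phi''(rF)$, $W(s)=\sum_{r=1}^R\phi(rs)$ and $W''_F=W''(F)=\sum_{r=1}^R r^2\phi''_{rF}$. For $N\ge 1$ identify $\mathbb{R}^N$ with the space of $N$-periodic real sequences $(u_\ell)_{\ell\in\mathbb{Z}}$, with norm $\|u\|=(\sum_{\ell=1}^N u_\ell^2)^{1/2}$, and define operators on it by $$(L^{\rm a}u)_\ell=\sum_{r=1}^R\phi''_{rF}\,(-u_{\ell+r}+2u_\ell-u_{\ell-r}),\qquad (L^{\rm c}u)_\ell=\sum_{r=1}^R\phi''_{rF}\,r^2\,(-u_{\ell+1}+2u_\ell-u_{\ell-1}).$$ For a set $\mathcal{A}\subseteq\{1,\dots,N\}$ with complement $\mathcal{C}=\{1,\dots,N\}\setminus\mathcal{A}$ let $(L^{\rm qcf}u)_\ell=(L^{\rm a}u)_\ell$ for $\ell\in\mathcal{A}$ and $(L^{\rm qcf}u)_\ell=(L^{\rm c}u)_\ell$ for $\ell\in\mathcal{C}$ (extended $N$-periodically), let $(P_{\mathcal U}u)_\ell=u_\ell-\frac1N\sum_{k=1}^N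 u_k$ be the orthogonal projection onto the mean-zero sequences, and set $L^{\rm qcf}_0=P_{\mathcal U}L^{\rm qcf}$. For an invertible operator $V$ let $\operatorname{cond}(V)=\|V\|\,\|V^{-1}\|$, with the operator norms induced by $\|\cdot\|$. **Theorem.** Suppose that $\phi''_{rF}\le 0$ for $2\le r\le R$ and that $\phi''_{RF}\ne 0$. Then for every $N\ge1$ and every $\mathcal{A}\subseteq\{1,\dots,N\}$ there is an invertible operator $V:\mathbb{R}^N\to\mathbb{R}^N$ with the following properties. (i) $V$ diagonalizes $L^{\rm qcf}_0$, that is, $L^{\rm qcf}_0V=V\Lambda$, where $\Lambda$ is the real diagonal matrix whose diagonal entries $\lambda_1\le\dots\le\lambda_N$ are the ordered eigenvalues of $L^{\rm qcf}_0$, repeated according to multiplicity; in particular all eigenvalues of $L^{\rm qcf}_0$ are real. (ii) If $W''_F>0$, then $\operatorname{cond}(V)$ is bounded above by a constant that depends only on $R$ and the coefficients $\phi''_{rF}$, $r=1,\dots,R$, and in particular is independent of $N$ and $\mathcal{A}$. (iii) If $W''_F>0$, then $$\lambda^{\rm c}_j\le\lambda_j\le\lambda^{\rm a}_j\qquad (j=1,\dots,N),$$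 where $\lambda^{\rm c}_1\le\dots\le\lambda^{\rm c}_N$ and $\lambda^{\rm a}_1\le\dots\le\lambda^{\rm a}_N$ are the ordered eigenvalues, repeated according to multiplicity, of $L^{\rm c}$ and $L^{\rm a}$ (all of which are real). In particular, $\lambda_1=0$ and $$4W''_F\sin^2\!\big(\tfrac{\pi}{N}\big)\le\lambda_j\le 4\phi''_F\qquad\text{for } j=2,\dots,N,$$ where $\phi''_F=\phi''_{1F}=\phi''(F)$. -/

import Mathlib

open Finset Polynomial

noncomputable section

namespace QCF

/-- The space `ℝ^N` of `N`-periodic real sequences, i.e. real functions on `ℤ/Nℤ`, with the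
`ℓ²` inner product and norm taken over one period. -/
abbrev Per (N : ℕ) : Type := EuclideanSpace ℝ (ZMod N)

/-- The coefficient `φ''_{rF} = φ''(rF)`. -/
def coeff (φ : ℝ → ℝ) (F : ℝ) (r : ℕ) : ℝ := iteratedDeriv 2 φ ((r : ℝ) * F)

/-- The Cauchy--Born stored energy function `W(s) = ∑_{r=1}^R φ(rs)`. -/
def cauchyBorn (φ : ℝ → ℝ) (R : ℕ) (s : ℝ) : ℝ := ∑ r ∈ Icc 1 R, φ ((r : ℝ) * s)

/-- The continuum elastic modulus `W''_F = W''(F)`. -/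
def modulus (φ : ℝ → ℝ) (R : ℕ) (F : ℝ) : ℝ := iteratedDeriv 2 (cauchyBorn φ R) F

variable {N : ℕ}

/-- The linearized atomistic operator,
`(Lᵃ u)_ℓ = ∑_{r=1}^R φ''_{rF} (- u_{ℓ+r} + 2 u_ℓ - u_{ℓ-r})`. -/
def atomisticOp (φ : ℝ → ℝ) (R : ℕ) (F : ℝ) : Per N →ₗ[ℝ] Per N where
  toFun u := WithLp.toLp 2 fun ℓ =>
    ∑ r ∈ Icc 1 R, coeff φ F r * (-u (ℓ + (r : ZMod N)) + 2 * u ℓ - u (ℓ - (r : ZMod N)))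
  map_add' u v := by
    ext ℓ
    simp only [PiLp.add_apply, ← Finset.sum_add_distrib]
    exact Finset.sum_congr rfl fun r _ => by ring
  map_smul' a u := by
    ext ℓ
    simp only [PiLp.smul_apply, smul_eq_mul, RingHom.id_apply, Finset.mul_sum]
    exact Finset.sum_congr rfl fun r _ => by ring

/-- The linearized continuum (Cauchy--Born) operator,
`(Lᶜ u)_ℓ = ∑_{r=1}^R φ''_{rF} r² (- u_{ℓ+1} + 2 u_ℓ - u_{ℓ-1})`. -/
def continuumOp (φ : ℝ → ℝ) (R : ℕ) (F : ℝ) : Per N →ₗ[ℝ] Per N where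
  toFun u := WithLp.toLp 2 fun ℓ =>
    ∑ r ∈ Icc 1 R, coeff φ F r * (r : ℝ) ^ 2 * (-u (ℓ + 1) + 2 * u ℓ - u (ℓ - 1))
  map_add' u v := by
    ext ℓ
    simp only [PiLp.add_apply, ← Finset.sum_add_distrib]
    exact Finset.sum_congr rfl fun r _ => by ring
  map_smul' a u := by
    ext ℓ
    simp only [PiLp.smul_apply, smul_eq_mul, RingHom.id_apply, Finset.mul_sum]
    exact Finset.sum_congr rfl fun r _ => by ring

/-- The QCF operator: atomistic at the sites in the atomistic region `A`, continuum at the sites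
of its complement. -/
def qcfOp (φ : ℝ → ℝ) (R : ℕ) (F : ℝ) (A : Finset (ZMod N)) : Per N →ₗ[ℝ] Per N where
  toFun u := WithLp.toLp 2 fun ℓ =>
    if ℓ ∈ A then atomisticOp φ R F u ℓ else continuumOp φ R F u ℓ
  map_add' u v := by
    ext ℓ
    by_cases h : ℓ ∈ A <;> simp [h]
  map_smul' a u := by
    ext ℓ
    by_cases h : ℓ ∈ A <;> simp [h]

/-- The orthogonal projection `P_U` onto the mean-zero sequences,
`(P_U u)_ℓ = u_ℓ - (1/N) ∑_k u_k`. -/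
def meanZeroProj [NeZero N] : Per N →ₗ[ℝ] Per N where
  toFun u := WithLp.toLp 2 fun ℓ => u ℓ - 1 / (N : ℝ) * ∑ k, u k
  map_add' u v := by
    ext ℓ
    simp only [PiLp.add_apply, Finset.sum_add_distrib]
    ring
  map_smul' a u := by
    ext ℓ
    simp only [PiLp.smul_apply, smul_eq_mul, RingHom.id_apply, ← Finset.mul_sum]
    ring

/-- The projected QCF operator `L₀ = P_U L`. -/
def qcfOp₀ [NeZero N] (φ : ℝ → ℝ) (R : ℕ) (F : ℝ) (A : Finset (ZMod N)) :
    Per N →ₗ[ℝ] Per N :=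
  meanZeroProj ∘ₗ qcfOp φ R F A

/-- `μ 0 ≤ μ 1 ≤ … ≤ μ (N-1)` is the ordered list of all the eigenvalues of `L`, repeated
according to (algebraic) multiplicity; all of them are real. -/
def IsOrderedEigenvalues [NeZero N] (L : Per N →ₗ[ℝ] Per N) (μ : Fin N → ℝ) : Prop :=
  Monotone μ ∧ L.charpoly = ∏ j, (X - C (μ j))

/-- The diagonal operator with diagonal entries `μ`. -/
def diagOp (μ : Fin N → ℝ) : EuclideanSpace ℝ (Fin N) →ₗ[ℝ] EuclideanSpace ℝ (Fin N) :=
  Matrix.toEuclideanLin (Matrix.diagonal μ)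

/-- The `ℓ²` condition number `‖V‖ ‖V⁻¹‖` of an invertible operator. -/
def cond [NeZero N] (V : EuclideanSpace ℝ (Fin N) ≃L[ℝ] Per N) : ℝ :=
  ‖(V : EuclideanSpace ℝ (Fin N) →L[ℝ] Per N)‖ *
    ‖(V.symm : Per N →L[ℝ] EuclideanSpace ℝ (Fin N))‖

end QCF

end

/-! Write L for the periodic negative Laplacian and w for W''_F. On an eigenvector of L with
eigenvalue t = 2 - 2 cos θ, the range-r second difference acts as 2 - 2 cos(rθ) = r² t - t² q_r(t),
where q_r is the polynomial `remainderQuotient`. Hence Lᶜ = wL and Lᵃ = wL + XL², where X is the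
function -∑ φ''_{rF} q_r of L. On [0,4] one has q_1 = 0, q_r ≥ 0, and q_r ≥ 1 for r ≥ 2, so the sign
hypotheses make X at least -φ''_{RF} > 0, uniformly in N.

With C = P 1_A P, the projected operator is wL + CXL² = TL, where T = w + CXL (`qcfOp₀_eq_forceOp`).
It is similar to the symmetric operator S = wL + (X^{1/2}L) C (X^{1/2}L), which yields real
eigenvalues and a diagonalizing V. If w > 0, the similarity is T X^{-1/2}; since 0 ≤ C ≤ 1 and XL is
bounded, its condition number is bounded independently of N and A (`exists_bounded_similarity`). If
w ≤ 0, X^{1/2}L, corrected on the constants, still serves as a similarity, without a uniform bound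
(`exists_similarity`).

From 0 ≤ C ≤ 1 also wL ≤ S ≤ wL + XL² as quadratic forms, and the min-max principle
(`eigenvalue_mono`) orders the eigenvalues. The explicit bounds come from `spectral_gap` and
`atomistic_symbol_le`. -/

namespace QCF

/-! ### Orthonormal eigenbases, min-max comparison, diagonal operators -/

section Spectral

variable {E : Type*} [NormedAddCommGroup E] [InnerProductSpace ℝ E]

local notation "⟪" x ", " y "⟫" => inner ℝ x y

/-- A symmetric operator has an orthonormal eigenbasis with increasing eigenvalues. -/
theorem exists_monotone_eigenbasis [FiniteDimensional ℝ E] {n : ℕ}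
    (hn : Module.finrank ℝ E = n) {S : E →ₗ[ℝ] E} (hS : S.IsSymmetric) :
    ∃ (q : OrthonormalBasis (Fin n) ℝ E) (ev : Fin n → ℝ), Monotone ev ∧
      ∀ j, S (q j) = ev j • q j := by
  refine ⟨(hS.eigenvectorBasis hn).reindex Fin.revPerm, fun j => hS.eigenvalues hn j.rev,
    fun i j h => hS.eigenvalues_antitone hn (Fin.rev_le_rev.mpr h), fun j => ?_⟩
  simp [OrthonormalBasis.reindex_apply, hS.apply_eigenvectorBasis hn]

variable {ι : Type*} [Fintype ι]

theorem inner_apply_of_eigenbasis (q : OrthonormalBasis ι ℝ E) {S : E →ₗ[ℝ] E} {ev : ι → ℝ}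
    (h : ∀ j, S (q j) = ev j • q j) (u : E) : ⟪S u, u⟫ = ∑ j, ev j * ⟪q j, u⟫ ^ 2 := by
  have h1 : S u = ∑ j, (ev j * ⟪q j, u⟫) • q j := by
    conv_lhs => rw [← q.sum_repr' u]
    simp [map_sum, h, smul_smul, mul_comm]
  rw [h1, sum_inner]
  refine Finset.sum_congr rfl fun j _ => ?_
  rw [real_inner_smul_left]; ring

theorem norm_sq_eq_sum (q : OrthonormalBasis ι ℝ E) (u : E) :
    ‖u‖ ^ 2 = ∑ j, ⟪q j, u⟫ ^ 2 := by
  rw [← q.sum_sq_norm_inner_right u]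
  simp

/-- Monotonicity of ordered eigenvalues with respect to the order of quadratic forms. -/
theorem eigenvalue_mono {n : ℕ} {S T : E →ₗ[ℝ] E} (p q : OrthonormalBasis (Fin n) ℝ E)
    {a b : Fin n → ℝ} (ha : Monotone a) (hb : Monotone b)
    (hS : ∀ j, S (p j) = a j • p j) (hT : ∀ j, T (q j) = b j • q j)
    (hST : ∀ u, ⟪S u, u⟫ ≤ ⟪T u, u⟫) (j : Fin n) : a j ≤ b j := by
  have : FiniteDimensional ℝ E := p.toBasis.finiteDimensional_of_finite
  -- Orthogonality to `p i` for i < j and to `q i` for i > j is only n - 1 conditions, so some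
  -- nonzero x meets them all. Its Rayleigh quotient is at least `a j` for S and at most `b j` for
  -- T.
  let f : E →ₗ[ℝ] ({i : Fin n // i ≠ j} → ℝ) :=
    LinearMap.pi fun i => if i.1 < j then (innerSL ℝ (p i.1)).toLinearMap
      else (innerSL ℝ (q i.1)).toLinearMap
  have hlt : Module.finrank ℝ ({i : Fin n // i ≠ j} → ℝ) < Module.finrank ℝ E := by
    have h0 : 0 < n := j.pos
    simp [Module.finrank_eq_card_basis p.toBasis, Fintype.card_subtype_compl]
    omega
  obtain ⟨x, hx, hx0⟩ := (Submodule.ne_bot_iff _).1 (LinearMap.ker_ne_bot_of_finrank_lt hlt (f := f))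
  have hp : ∀ i, i < j → ⟪p i, x⟫ = 0 := fun i hi => by
    have := congrFun (LinearMap.mem_ker.1 hx) ⟨i, hi.ne⟩
    simpa [f, hi] using this
  have hq : ∀ i, j < i → ⟪q i, x⟫ = 0 := fun i hi => by
    have := congrFun (LinearMap.mem_ker.1 hx) ⟨i, hi.ne'⟩
    simpa [f, hi.not_gt] using this
  have h1 : a j * ‖x‖ ^ 2 ≤ ⟪S x, x⟫ := by
    rw [inner_apply_of_eigenbasis p hS, norm_sq_eq_sum p, Finset.mul_sum]
    refine Finset.sum_le_sum fun i _ => ?_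
    rcases lt_or_ge i j with h | h
    · simp [hp i h]
    · exact mul_le_mul_of_nonneg_right (ha h) (sq_nonneg _)
  have h2 : ⟪T x, x⟫ ≤ b j * ‖x‖ ^ 2 := by
    rw [inner_apply_of_eigenbasis q hT, norm_sq_eq_sum q, Finset.mul_sum]
    refine Finset.sum_le_sum fun i _ => ?_
    rcases lt_or_ge j i with h | h
    · simp [hq i h]
    · exact mul_le_mul_of_nonneg_right (hb h) (sq_nonneg _)
  have h3 : 0 < ‖x‖ ^ 2 := by positivity
  exact le_of_mul_le_mul_right (h1.trans ((hST x).trans h2)) h3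

/-- The operator acting on the orthonormal basis `b` by multiplication with `d`. -/
noncomputable def basisDiag (b : OrthonormalBasis ι ℝ E) (d : ι → ℝ) : E →ₗ[ℝ] E :=
  b.toBasis.constr ℝ fun i => d i • b i

variable (b : OrthonormalBasis ι ℝ E) (d e : ι → ℝ)

@[simp]
theorem basisDiag_basis (i : ι) : basisDiag b d (b i) = d i • b i := by
  have := b.toBasis.constr_basis ℝ (fun i => d i • b i) i
  simpa [basisDiag] using this

theorem inner_basisDiag (u : E) (i : ι) : ⟪b i, basisDiag b d u⟫ = d i * ⟪b i, u⟫ := by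
  classical
  conv_lhs => rw [← b.sum_repr' u]
  simp [map_sum, inner_sum, inner_smul_right, orthonormal_iff_ite.1 b.orthonormal]
  ring

theorem ext_inner_basis {u v : E} (h : ∀ i, ⟪b i, u⟫ = ⟪b i, v⟫) : u = v := by
  rw [← b.sum_repr' u, ← b.sum_repr' v]
  simp [h]

theorem eq_basisDiag {S : E →ₗ[ℝ] E} (h : ∀ i, S (b i) = d i • b i) : S = basisDiag b d :=
  b.toBasis.ext fun i => by simp [h]

theorem basisDiag_basisDiag (u : E) :
    basisDiag b d (basisDiag b e u) = basisDiag b (fun i => d i * e i) u :=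
  ext_inner_basis b fun i => by simp [inner_basisDiag, mul_assoc]

theorem basisDiag_isSymmetric : (basisDiag b d).IsSymmetric := fun u v => by
  rw [← b.sum_inner_mul_inner, ← b.sum_inner_mul_inner]
  refine Finset.sum_congr rfl fun i _ => ?_
  rw [inner_basisDiag, real_inner_comm, inner_basisDiag, real_inner_comm]
  ring

theorem norm_basisDiag_le {c : ℝ} (hc : 0 ≤ c) (h : ∀ i, |d i| ≤ c) (u : E) :
    ‖basisDiag b d u‖ ≤ c * ‖u‖ := by
  refine le_of_sq_le_sq ?_ (by positivity)
  rw [mul_pow, norm_sq_eq_sum b, norm_sq_eq_sum b, Finset.mul_sum]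
  refine Finset.sum_le_sum fun i _ => ?_
  rw [inner_basisDiag, mul_pow]
  exact mul_le_mul_of_nonneg_right (sq_le_sq.2 (by rw [abs_of_nonneg hc]; exact h i)) (sq_nonneg _)

end Spectral

/-! ### Similarity between the force operator and its symmetrization -/

section Similarity

variable {E : Type*} [NormedAddCommGroup E] [InnerProductSpace ℝ E]
  {ι : Type*} [Fintype ι]

local notation "⟪" x ", " y "⟫" => inner ℝ x y

variable (b : OrthonormalBasis ι ℝ E) (w : ℝ) (t x : ι → ℝ) (C : E →ₗ[ℝ] E)

/-- The operator `w L + C X L²`, where `L` and `X` act on `b` by `t` and `x`. -/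
noncomputable def forceOp : E →ₗ[ℝ] E :=
  w • basisDiag b t + C ∘ₗ basisDiag b (fun i => x i * t i ^ 2)

/-- The symmetric operator `w L + (X^{1/2} L) C (X^{1/2} L)`. -/
noncomputable def symmOp : E →ₗ[ℝ] E :=
  w • basisDiag b t +
    basisDiag b (fun i => √(x i) * t i) ∘ₗ C ∘ₗ basisDiag b (fun i => √(x i) * t i)

theorem symmOp_isSymmetric (hC : C.IsSymmetric) : (symmOp b w t x C).IsSymmetric := by
  intro u v
  have h := basisDiag_isSymmetric b (fun i => √(x i) * t i)
  simp only [symmOp, LinearMap.add_apply, LinearMap.smul_apply, LinearMap.comp_apply,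
    inner_add_left, inner_add_right, real_inner_smul_left, real_inner_smul_right]
  rw [basisDiag_isSymmetric b t u v, h _ v, hC _ _, h u]

theorem symmOp_apply_eq_zero {u : E} (h : basisDiag b t u = 0) : symmOp b w t x C u = 0 := by
  have h' : basisDiag b (fun i => √(x i) * t i) u = 0 := by
    rw [← basisDiag_basisDiag, h, map_zero]
  simp [symmOp, h, h']

theorem inner_symmOp (u : E) :
    ⟪symmOp b w t x C u, u⟫ = w * ⟪basisDiag b t u, u⟫ +
      ⟪C (basisDiag b (fun i => √(x i) * t i) u), basisDiag b (fun i => √(x i) * t i) u⟫ := by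
  simp only [symmOp, LinearMap.add_apply, LinearMap.smul_apply, LinearMap.comp_apply,
    inner_add_left, real_inner_smul_left]
  rw [basisDiag_isSymmetric b (fun i => √(x i) * t i) _ u]

theorem inner_symmOp_ge (hC : ∀ v, 0 ≤ ⟪C v, v⟫) (u : E) :
    ⟪(w • basisDiag b t) u, u⟫ ≤ ⟪symmOp b w t x C u, u⟫ := by
  rw [inner_symmOp, LinearMap.smul_apply, real_inner_smul_left]
  exact le_add_of_nonneg_right (hC _)

/-- Replacing C by the identity turns the sandwiched term into XL², which is diagonal in `b`. -/
theorem inner_symmOp_le (hx : ∀ i, 0 ≤ x i) (hC : ∀ v, ⟪C v, v⟫ ≤ ‖v‖ ^ 2) (u : E) :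
    ⟪symmOp b w t x C u, u⟫ ≤ ⟪basisDiag b (fun i => w * t i + x i * t i ^ 2) u, u⟫ := by
  rw [inner_symmOp]
  refine (add_le_add le_rfl (hC _)).trans (le_of_eq ?_)
  rw [inner_apply_of_eigenbasis b (basisDiag_basis b t),
    inner_apply_of_eigenbasis b (basisDiag_basis b _), norm_sq_eq_sum b, Finset.mul_sum,
    ← Finset.sum_add_distrib]
  refine Finset.sum_congr rfl fun i _ => ?_
  rw [inner_basisDiag, mul_pow, mul_pow, Real.sq_sqrt (hx i)]
  ring

variable [FiniteDimensional ℝ E]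

/-- For positive `w` the operators `forceOp` and `symmOp` are similar by a well-conditioned
transformation. -/
theorem exists_bounded_similarity {α β g : ℝ} (hw : 0 < w) (hα : 0 < α) (hg : 0 ≤ g)
    (hxα : ∀ i, α ≤ x i) (hxβ : ∀ i, x i ≤ β) (ht : ∀ i, 0 ≤ t i) (hxt : ∀ i, x i * t i ≤ g)
    (hC0 : ∀ v, 0 ≤ ⟪C v, v⟫) (hC1 : ∀ v, ‖C v‖ ≤ ‖v‖) :
    ∃ M : E ≃ₗ[ℝ] E, (∀ u, forceOp b w t x C (M u) = M (symmOp b w t x C u)) ∧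
      (∀ u, ‖M u‖ ≤ (w + g) / √α * ‖u‖) ∧ (∀ u, ‖u‖ ≤ (w + g) / w ^ 2 * √β * ‖M u‖) := by
  have hx : ∀ i, 0 < x i := fun i => hα.trans_le (hxα i)
  have hsx : ∀ i, 0 < √(x i) := fun i => Real.sqrt_pos.2 (hx i)
  -- With D = X^{-1/2}, `forceOp` = TL and D `symmOp` = L T D, so T D intertwines the two operators.
  let T : E →ₗ[ℝ] E := w • LinearMap.id + C ∘ₗ basisDiag b (fun i => x i * t i)
  have hxt0 : ∀ i, 0 ≤ x i * t i := fun i => mul_nonneg (hx i).le (ht i)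
  have hG : ∀ u, ‖basisDiag b (fun i => x i * t i) u‖ ≤ g * ‖u‖ := fun u =>
    norm_basisDiag_le b _ hg (fun i => by rw [abs_of_nonneg (hxt0 i)]; exact hxt i) u
  have hTu : ∀ u, ‖T u‖ ≤ (w + g) * ‖u‖ := fun u => by
    calc ‖T u‖ ≤ ‖w • u‖ + ‖C (basisDiag b (fun i => x i * t i) u)‖ := norm_add_le _ _
      _ ≤ w * ‖u‖ + g * ‖u‖ := by
        rw [norm_smul, Real.norm_of_nonneg hw.le]
        exact add_le_add le_rfl ((hC1 _).trans (hG u))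
      _ = _ := by ring
  have hTl : ∀ u, ‖u‖ ≤ (w + g) / w ^ 2 * ‖T u‖ := fun u => by
    -- Testing Tu against y = XLu, rather than u, makes the C term nonnegative: w⟨u,y⟩ ≤ ⟨Tu,y⟩. As
    -- 0 ≤ XL ≤ g gives ‖y‖² ≤ g⟨u,y⟩, it follows that w‖y‖ ≤ g‖Tu‖, and u is recovered from wu = Tu
    -- - Cy.
    set y := basisDiag b (fun i => x i * t i) u with hy
    have h1 : T u = w • u + C y := rfl
    have h2 : ‖y‖ ^ 2 ≤ g * ⟪u, y⟫ := by
      rw [real_inner_comm, hy, inner_apply_of_eigenbasis b (basisDiag_basis b _),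
        norm_sq_eq_sum b, Finset.mul_sum]
      refine Finset.sum_le_sum fun i _ => ?_
      rw [inner_basisDiag, mul_pow, ← mul_assoc]
      refine mul_le_mul_of_nonneg_right ?_ (sq_nonneg _)
      rw [sq]
      exact mul_le_mul_of_nonneg_right (hxt i) (hxt0 i)
    have h3 : w * ⟪u, y⟫ ≤ ‖T u‖ * ‖y‖ := by
      refine le_trans ?_ (real_inner_le_norm (T u) y)
      rw [h1, inner_add_left, real_inner_smul_left]
      exact le_add_of_nonneg_right (hC0 y)
    have h4 : w * ‖y‖ ≤ g * ‖T u‖ := by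
      rcases (norm_nonneg y).eq_or_lt with h | h
      · rw [← h, mul_zero]; positivity
      · refine le_of_mul_le_mul_right ?_ h
        nlinarith [mul_le_mul_of_nonneg_left h2 hw.le, mul_le_mul_of_nonneg_left h3 hg]
    have h5 : w * ‖u‖ ≤ ‖T u‖ + ‖y‖ := by
      have : w • u = T u - C y := by rw [h1]; abel
      calc w * ‖u‖ = ‖w • u‖ := by rw [norm_smul, Real.norm_of_nonneg hw.le]
        _ ≤ ‖T u‖ + ‖C y‖ := by rw [this]; exact norm_sub_le _ _
        _ ≤ _ := add_le_add le_rfl (hC1 y)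
    rw [div_mul_eq_mul_div, le_div_iff₀ (by positivity)]
    nlinarith [mul_le_mul_of_nonneg_left h5 hw.le]
  let D : E →ₗ[ℝ] E := basisDiag b (fun i => (√(x i))⁻¹)
  have hDu : ∀ u, ‖D u‖ ≤ (√α)⁻¹ * ‖u‖ := fun u =>
    norm_basisDiag_le b _ (by positivity) (fun i => by
      rw [abs_of_nonneg (inv_nonneg.2 (hsx i).le)]
      exact inv_anti₀ (Real.sqrt_pos.2 hα) (Real.sqrt_le_sqrt (hxα i))) u
  have hDl : ∀ u, ‖u‖ ≤ √β * ‖D u‖ := fun u => by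
    have h := norm_basisDiag_le b (fun i => √(x i)) (Real.sqrt_nonneg β) (fun i => by
      rw [abs_of_nonneg (hsx i).le]
      exact Real.sqrt_le_sqrt (hxβ i)) (D u)
    have h' : basisDiag b (fun i => √(x i)) (D u) = u := by
      rw [basisDiag_basisDiag]
      refine ext_inner_basis b fun i => ?_
      rw [inner_basisDiag, mul_inv_cancel₀ (hsx i).ne', one_mul]
    rwa [h'] at h
  have hMl : ∀ u, ‖u‖ ≤ (w + g) / w ^ 2 * √β * ‖T (D u)‖ := fun u => by
    calc ‖u‖ ≤ √β * ‖D u‖ := hDl u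
      _ ≤ √β * ((w + g) / w ^ 2 * ‖T (D u)‖) :=
        mul_le_mul_of_nonneg_left (hTl _) (Real.sqrt_nonneg _)
      _ = _ := by ring
  have hinj : Function.Injective (T ∘ₗ D) := by
    rw [← LinearMap.ker_eq_bot, LinearMap.ker_eq_bot']
    intro u hu
    have := hMl u
    rw [show T (D u) = 0 from hu, norm_zero, mul_zero] at this
    exact norm_le_zero_iff.1 this
  refine ⟨LinearEquiv.ofInjectiveEndo (T ∘ₗ D) hinj, fun u => ?_, fun u => ?_, fun u => ?_⟩
  · have e1 : ∀ u, (T ∘ₗ D) u = w • D u + C (basisDiag b (fun i => √(x i) * t i) u) := by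
      intro u
      simp only [T, D, LinearMap.add_apply, LinearMap.smul_apply, LinearMap.comp_apply,
        LinearMap.id_apply, basisDiag_basisDiag]
      congr 4
      funext i
      rw [mul_right_comm, ← div_eq_mul_inv, Real.div_sqrt]
    have e2 : ∀ i, (√(x i))⁻¹ * (√(x i) * t i) = t i := fun i => by
      rw [← mul_assoc, inv_mul_cancel₀ (hsx i).ne', one_mul]
    have e3 : ∀ i, x i * t i ^ 2 * (√(x i))⁻¹ = √(x i) * t i * t i := fun i => by
      rw [mul_right_comm, ← div_eq_mul_inv, Real.div_sqrt]
      ring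
    have e4 : ∀ i, √(x i) * t i * (√(x i) * t i) = x i * t i ^ 2 := fun i => by
      rw [mul_mul_mul_comm, Real.mul_self_sqrt (hx i).le, sq]
    have e5 : ∀ i, t i * (√(x i))⁻¹ = (√(x i))⁻¹ * t i := fun i => mul_comm _ _
    simp only [LinearEquiv.coe_ofInjectiveEndo, e1, forceOp, symmOp, D, LinearMap.add_apply,
      LinearMap.smul_apply, LinearMap.comp_apply, map_add, map_smul, basisDiag_basisDiag, e2, e3,
      e4, e5, smul_add]

  · rw [LinearEquiv.coe_ofInjectiveEndo]
    calc ‖T (D u)‖ ≤ (w + g) * ‖D u‖ := hTu _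
      _ ≤ (w + g) * ((√α)⁻¹ * ‖u‖) := mul_le_mul_of_nonneg_left (hDu u) (by positivity)
      _ = _ := by ring
  · rw [LinearEquiv.coe_ofInjectiveEndo]
    exact hMl u

/-- Similarity of `forceOp` and `symmOp` without any sign condition on `w`. -/
theorem exists_similarity (hx : ∀ i, 0 < x i) (hC : ∀ i, t i = 0 → C (b i) = 0)
    (hCs : C.IsSymmetric) :
    ∃ M : E ≃ₗ[ℝ] E, ∀ u, forceOp b w t x C (M u) = M (symmOp b w t x C u) := by
  classical
  -- X^{1/2}L conjugates in the reverse direction but is singular on ker L; the value 1 there makes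
  -- it invertible.
  let d : ι → ℝ := fun i => if t i = 0 then 1 else √(x i) * t i
  have hd : ∀ i, d i ≠ 0 := fun i => by
    by_cases h : t i = 0 <;> simp [d, h, (Real.sqrt_pos.2 (hx i)).ne']
  have hinj : Function.Injective (basisDiag b d) := by
    rw [← LinearMap.ker_eq_bot, LinearMap.ker_eq_bot']
    intro u hu
    refine ext_inner_basis b fun i => ?_
    have := inner_basisDiag b d u i
    rw [hu, inner_zero_right] at this
    rw [inner_zero_right]
    exact (mul_eq_zero.1 this.symm).resolve_left (hd i)
  let M := LinearEquiv.ofInjectiveEndo (basisDiag b d) hinj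
  have key : ∀ v, M (forceOp b w t x C v) = symmOp b w t x C (M v) := fun v => by
    refine ext_inner_basis b fun i => ?_
    simp only [M, LinearEquiv.coe_ofInjectiveEndo, forceOp, symmOp, LinearMap.add_apply,
      LinearMap.smul_apply, LinearMap.comp_apply, inner_basisDiag, inner_add_right,
      inner_smul_right, basisDiag_basisDiag]
    have e1 : (fun i => √(x i) * t i * d i) = fun i => x i * t i ^ 2 := by
      funext i
      by_cases h : t i = 0
      · simp [h]
      · simp only [d, h, if_false]
        rw [mul_mul_mul_comm, Real.mul_self_sqrt (hx i).le, sq]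
    rw [e1]
    by_cases h : t i = 0
    -- On ker L the modified factor does no harm: C is symmetric and kills `b i`, so the range of C
    -- has no component along `b i`.
    · rw [← hCs (b i), hC i h]
      simp [h]
    · simp only [d, h, if_false]
      ring
  refine ⟨M.symm, fun u => M.injective ?_⟩
  rw [key, LinearEquiv.apply_symm_apply, LinearEquiv.apply_symm_apply]

end Similarity

/-! ### Chebyshev-type remainder polynomials on [0, 4] -/

/-- The quotient `(r² t - (2 - 2 cos (r θ))) / t²`, a polynomial in `t = 2 - 2 cos θ`. -/
def remainderQuotient (t : ℝ) : ℕ → ℝ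
  | 0 => 0
  | 1 => 0
  | r + 2 => (2 - t) * remainderQuotient t (r + 1) - remainderQuotient t r + ((r : ℝ) + 1) ^ 2

theorem cos_add_two_mul (r : ℕ) (θ : ℝ) : Real.cos (((r + 2 : ℕ) : ℝ) * θ) =
    2 * Real.cos θ * Real.cos (((r + 1 : ℕ) : ℝ) * θ) - Real.cos (r * θ) := by
  have h1 : ((r + 2 : ℕ) : ℝ) * θ = ((r + 1 : ℕ) : ℝ) * θ + θ := by push_cast; ring
  have h2 : (r : ℝ) * θ = ((r + 1 : ℕ) : ℝ) * θ - θ := by push_cast; ring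
  rw [h1, h2, Real.cos_add, Real.cos_sub]
  ring

theorem sq_mul_remainderQuotient (θ : ℝ) (r : ℕ) :
    (r : ℝ) ^ 2 * (2 - 2 * Real.cos θ) - (2 - 2 * Real.cos (r * θ)) =
      (2 - 2 * Real.cos θ) ^ 2 * remainderQuotient (2 - 2 * Real.cos θ) r := by
  induction r using Nat.twoStepInduction with
  | zero => simp [remainderQuotient]
  | one => simp [remainderQuotient]
  | more r h0 h1 =>
    rw [cos_add_two_mul, remainderQuotient]
    push_cast at h0 h1 ⊢
    linear_combination (2 * Real.cos θ) * h1 - h0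

variable {t : ℝ}

/-- For t = 2 - 2 cos θ, t(r² - t q_r) = 2 - 2 cos(rθ) ≥ 0. -/
theorem mul_remainderQuotient_le (h0 : 0 ≤ t) (h4 : t ≤ 4) (r : ℕ) :
    t * remainderQuotient t r ≤ (r : ℝ) ^ 2 := by
  rcases h0.eq_or_lt with h | h
  · rw [← h, zero_mul]; positivity
  · have hc : Real.cos (Real.arccos (1 - t / 2)) = 1 - t / 2 :=
      Real.cos_arccos (by linarith) (by linarith)
    have key := sq_mul_remainderQuotient (Real.arccos (1 - t / 2)) r
    rw [hc, show 2 - 2 * (1 - t / 2) = t by ring] at key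
    have h1 := Real.cos_le_one (r * Real.arccos (1 - t / 2))
    refine le_of_mul_le_mul_left ?_ h
    nlinarith

/-- The second difference of q in r is (r+1)² - t q_{r+1}, which the previous bound makes
nonnegative on [0, 4]. Convexity in r together with q_0 = q_1 = 0 then gives monotonicity. -/
theorem remainderQuotient_add_two_sub (r : ℕ) :
    remainderQuotient t (r + 2) - remainderQuotient t (r + 1) =
      remainderQuotient t (r + 1) - remainderQuotient t r +
        (((r + 1 : ℕ) : ℝ) ^ 2 - t * remainderQuotient t (r + 1)) := by
  rw [remainderQuotient]; push_cast; ring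

theorem remainderQuotient_mono (h0 : 0 ≤ t) (h4 : t ≤ 4) (r : ℕ) :
    remainderQuotient t r ≤ remainderQuotient t (r + 1) := by
  induction r with
  | zero => simp [remainderQuotient]
  | succ r ih =>
    have := remainderQuotient_add_two_sub (t := t) r
    have := mul_remainderQuotient_le h0 h4 (r + 1)
    linarith

theorem remainderQuotient_nonneg (h0 : 0 ≤ t) (h4 : t ≤ 4) (r : ℕ) :
    0 ≤ remainderQuotient t r :=
  monotone_nat_of_le_succ (remainderQuotient_mono h0 h4) (Nat.zero_le r)

theorem one_le_remainderQuotient (h0 : 0 ≤ t) (h4 : t ≤ 4) {r : ℕ} (hr : 2 ≤ r) :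
    1 ≤ remainderQuotient t r := by
  refine le_trans ?_ (monotone_nat_of_le_succ (remainderQuotient_mono h0 h4) hr)
  simp [remainderQuotient]

/-- Since t q ≥ 0, second differences are at most (r+1)²; summing twice gives increments at most r³
and values at most r⁴. -/
theorem remainderQuotient_le (h0 : 0 ≤ t) (h4 : t ≤ 4) (r : ℕ) :
    remainderQuotient t r ≤ (r : ℝ) ^ 4 := by
  have hd : ∀ r : ℕ, remainderQuotient t (r + 1) - remainderQuotient t r ≤ (r : ℝ) ^ 3 := by
    intro r
    induction r with
    | zero => simp [remainderQuotient]
    | succ r ih =>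
      have h1 := remainderQuotient_add_two_sub (t := t) r
      have h2 := mul_nonneg h0 (remainderQuotient_nonneg h0 h4 (r + 1))
      have h3 : (0 : ℝ) ≤ r := r.cast_nonneg
      push_cast at h1 ⊢
      have : (0 : ℝ) ≤ (r : ℝ) ^ 2 := by positivity
      nlinarith
  induction r with
  | zero => simp [remainderQuotient]
  | succ r ih =>
    have h1 := hd r
    have h3 : (0 : ℝ) ≤ r := r.cast_nonneg
    push_cast
    have : 0 ≤ (r : ℝ) ^ 3 := by positivity
    have : 0 ≤ (r : ℝ) ^ 2 := by positivity
    nlinarith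

/-! ### Orthogonal projections as positive contractions -/

section Projection

variable {E : Type*} [NormedAddCommGroup E] [InnerProductSpace ℝ E] {Q : E →ₗ[ℝ] E}

theorem inner_apply_eq_norm_sq (hQ : Q.IsSymmetric) (hQQ : ∀ v, Q (Q v) = Q v) (v : E) :
    inner ℝ (Q v) v = ‖Q v‖ ^ 2 := by
  rw [← real_inner_self_eq_norm_sq, ← hQ (Q v) v, hQQ]

theorem norm_apply_le (hQ : Q.IsSymmetric) (hQQ : ∀ v, Q (Q v) = Q v) (v : E) :
    ‖Q v‖ ≤ ‖v‖ := by
  have h1 := inner_apply_eq_norm_sq hQ hQQ v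
  have h2 := real_inner_le_norm (Q v) v
  rcases (norm_nonneg (Q v)).eq_or_lt with h | h
  · rw [← h]; exact norm_nonneg v
  · refine le_of_mul_le_mul_left ?_ h
    nlinarith

end Projection

/-! ### The periodic Laplacian, its eigenvectors and the operator symbols -/

variable {N : ℕ}

/-- The negative discrete Laplacian. -/
noncomputable def laplacian : Per N →ₗ[ℝ] Per N where
  toFun u := WithLp.toLp 2 fun ℓ => -u (ℓ + 1) + 2 * u ℓ - u (ℓ - 1)
  map_add' u v := by
    ext ℓ
    simp only [PiLp.add_apply]
    ring
  map_smul' a u := by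
    ext ℓ
    simp only [PiLp.smul_apply, smul_eq_mul, RingHom.id_apply]
    ring

/-- Multiplication by the indicator function of `A`. -/
noncomputable def indicatorOp (A : Finset (ZMod N)) : Per N →ₗ[ℝ] Per N where
  toFun u := WithLp.toLp 2 fun ℓ => if ℓ ∈ A then u ℓ else 0
  map_add' u v := by
    ext ℓ
    by_cases h : ℓ ∈ A <;> simp [h]
  map_smul' a u := by
    ext ℓ
    by_cases h : ℓ ∈ A <;> simp [h]

theorem laplacian_apply (u : Per N) (ℓ : ZMod N) :
    laplacian u ℓ = -u (ℓ + 1) + 2 * u ℓ - u (ℓ - 1) := rfl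

theorem indicatorOp_apply (A : Finset (ZMod N)) (u : Per N) (ℓ : ZMod N) :
    indicatorOp A u ℓ = if ℓ ∈ A then u ℓ else 0 := rfl

/-- The eigenvalue equation is the case r = 1, and the cosine recurrence propagates it to all r.
This replaces an explicit Fourier basis. -/
theorem shift_add_shift {v : Per N} {θ : ℝ} (h : laplacian v = (2 - 2 * Real.cos θ) • v) (r : ℕ)
    (ℓ : ZMod N) : v (ℓ + (r : ZMod N)) + v (ℓ - (r : ZMod N)) = 2 * Real.cos (r * θ) * v ℓ := by
  have h1 : ∀ ℓ, v (ℓ + 1) + v (ℓ - 1) = 2 * Real.cos θ * v ℓ := fun ℓ => by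
    have := congrArg (fun u : Per N => u ℓ) h
    simp only [laplacian_apply, PiLp.smul_apply, smul_eq_mul] at this
    linarith
  induction r using Nat.twoStepInduction with
  | zero => simp; ring
  | one => simpa using h1 ℓ
  | more r ih0 ih1 =>
    have e1 := h1 (ℓ + ((r + 1 : ℕ) : ZMod N))
    have e2 := h1 (ℓ - ((r + 1 : ℕ) : ZMod N))
    rw [cos_add_two_mul]
    have a1 : ℓ + ((r + 1 : ℕ) : ZMod N) + 1 = ℓ + ((r + 2 : ℕ) : ZMod N) := by push_cast; ring
    have a2 : ℓ + ((r + 1 : ℕ) : ZMod N) - 1 = ℓ + (r : ZMod N) := by push_cast; ring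
    have a3 : ℓ - ((r + 1 : ℕ) : ZMod N) + 1 = ℓ - (r : ZMod N) := by push_cast; ring
    have a4 : ℓ - ((r + 1 : ℕ) : ZMod N) - 1 = ℓ - ((r + 2 : ℕ) : ZMod N) := by push_cast; ring
    rw [a1, a2] at e1
    rw [a3, a4] at e2
    linear_combination e1 + e2 + 2 * Real.cos θ * ih1 - ih0

theorem exists_angle {t : ℝ} (h0 : 0 ≤ t) (h4 : t ≤ 4) :
    ∃ θ, 0 ≤ θ ∧ θ ≤ Real.pi ∧ t = 2 - 2 * Real.cos θ :=
  ⟨Real.arccos (1 - t / 2), Real.arccos_nonneg _, Real.arccos_le_pi _, by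
    rw [Real.cos_arccos (by linarith) (by linarith)]; ring⟩

section Symbols

variable (φ : ℝ → ℝ) (R : ℕ) (F : ℝ)

/-- The symbol of `(Lᵃ - Lᶜ) / L²` as a function of the symbol of the Laplacian `L`. -/
noncomputable def diffSymbol (t : ℝ) : ℝ :=
  ∑ r ∈ Icc 1 R, -coeff φ F r * remainderQuotient t r

/-- The modulus `∑_{r=1}^R r² φ''_{rF}`. -/
noncomputable def elasticSum : ℝ := ∑ r ∈ Icc 1 R, coeff φ F r * (r : ℝ) ^ 2

theorem continuumOp_eq : continuumOp φ R F = elasticSum φ R F • laplacian (N := N) := by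
  ext u ℓ
  change ∑ r ∈ Icc 1 R, coeff φ F r * (r : ℝ) ^ 2 * (-u (ℓ + 1) + 2 * u ℓ - u (ℓ - 1)) =
    elasticSum φ R F * (-u (ℓ + 1) + 2 * u ℓ - u (ℓ - 1))
  rw [← Finset.sum_mul, elasticSum]

end Symbols

theorem indicatorOp_idem (A : Finset (ZMod N)) (u : Per N) :
    indicatorOp A (indicatorOp A u) = indicatorOp A u := by
  ext ℓ
  by_cases h : ℓ ∈ A <;> simp [indicatorOp_apply, h]

variable [NeZero N]

theorem meanZeroProj_apply (u : Per N) (ℓ : ZMod N) :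
    meanZeroProj u ℓ = u ℓ - 1 / (N : ℝ) * ∑ k, u k := rfl

theorem inner_per (u v : Per N) : inner ℝ u v = ∑ ℓ, u ℓ * v ℓ := by
  simp [PiLp.inner_apply, mul_comm]

theorem sum_shift (f : ZMod N → ℝ) (a : ZMod N) : ∑ ℓ, f (ℓ + a) = ∑ ℓ, f ℓ :=
  Equiv.sum_comp (Equiv.addRight a) f

theorem sum_shift_sub (f : ZMod N → ℝ) (a : ZMod N) : ∑ ℓ, f (ℓ - a) = ∑ ℓ, f ℓ :=
  Equiv.sum_comp (Equiv.subRight a) f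

/-- Summation by parts over one period; positivity, symmetry and the description of the kernel all
follow from this form. -/
theorem inner_laplacian (u v : Per N) :
    inner ℝ (laplacian u) v = ∑ ℓ, (u (ℓ + 1) - u ℓ) * (v (ℓ + 1) - v ℓ) := by
  have h1 := sum_shift (fun ℓ => u ℓ * v ℓ) 1
  have h2 := sum_shift_sub (fun ℓ => u ℓ * v (ℓ + 1)) 1
  simp only [sub_add_cancel] at h2
  have h3 : ∑ ℓ, ((-u (ℓ + 1) + 2 * u ℓ - u (ℓ - 1)) * v ℓ -
      (u (ℓ + 1) - u ℓ) * (v (ℓ + 1) - v ℓ)) =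
      ∑ ℓ, u ℓ * v ℓ - ∑ ℓ, u (ℓ + 1) * v (ℓ + 1) +
        (∑ ℓ, u ℓ * v (ℓ + 1) - ∑ ℓ, u (ℓ - 1) * v ℓ) := by
    simp only [← Finset.sum_sub_distrib, ← Finset.sum_add_distrib]
    exact Finset.sum_congr rfl fun ℓ _ => by ring
  rw [inner_per, ← sub_eq_zero, ← Finset.sum_sub_distrib]
  simp only [laplacian_apply]
  rw [h3, h1, h2]
  ring

theorem laplacian_isSymmetric : (laplacian (N := N)).IsSymmetric := fun u v => by
  rw [inner_laplacian, real_inner_comm, inner_laplacian]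
  exact Finset.sum_congr rfl fun ℓ _ => mul_comm _ _

theorem inner_laplacian_self_le (u : Per N) : inner ℝ (laplacian u) u ≤ 4 * ‖u‖ ^ 2 := by
  rw [inner_laplacian, ← real_inner_self_eq_norm_sq, inner_per]
  have h1 := sum_shift (fun ℓ => u ℓ * u ℓ) 1
  have h2 : ∑ ℓ, (u (ℓ + 1) - u ℓ) * (u (ℓ + 1) - u ℓ) ≤
      ∑ ℓ, (2 * (u (ℓ + 1) * u (ℓ + 1)) + 2 * (u ℓ * u ℓ)) :=
    Finset.sum_le_sum fun ℓ _ => by nlinarith [sq_nonneg (u (ℓ + 1) + u ℓ)]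
  rw [Finset.sum_add_distrib, ← Finset.mul_sum, ← Finset.mul_sum, h1] at h2
  linarith

theorem eq_const_of_laplacian_eq_zero {u : Per N} (h : laplacian u = 0) (ℓ : ZMod N) :
    u ℓ = u 0 := by
  have h0 : ∑ ℓ, (u (ℓ + 1) - u ℓ) * (u (ℓ + 1) - u ℓ) = 0 := by
    rw [← inner_laplacian, h, inner_zero_left]
  have h1 : ∀ ℓ, u (ℓ + 1) = u ℓ := fun ℓ => by
    have := (Finset.sum_eq_zero_iff_of_nonneg fun ℓ _ => mul_self_nonneg _).1 h0 ℓ (mem_univ _)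
    exact sub_eq_zero.1 (mul_self_eq_zero.1 this)
  have h2 : ∀ n : ℕ, u (n : ZMod N) = u 0 := fun n => by
    induction n with
    | zero => simp
    | succ n ih => rw [Nat.cast_succ, h1, ih]
  rw [← ZMod.natCast_zmod_val ℓ, h2]

section Eigenvector

variable {v : Per N} {t : ℝ}

theorem eigenvalue_mem_Icc (h : laplacian v = t • v) (hv : v ≠ 0) : 0 ≤ t ∧ t ≤ 4 := by
  have hp : 0 < ‖v‖ ^ 2 := by positivity
  have h1 : inner ℝ (laplacian v) v = t * ‖v‖ ^ 2 := by
    rw [h, real_inner_smul_left, real_inner_self_eq_norm_sq]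
  have h2 : 0 ≤ inner ℝ (laplacian v) v := by
    rw [inner_laplacian]; exact Finset.sum_nonneg fun _ _ => mul_self_nonneg _
  have h3 := inner_laplacian_self_le v
  rw [h1] at h2 h3
  exact ⟨nonneg_of_mul_nonneg_left h2 hp, le_of_mul_le_mul_right h3 hp⟩

/-- The nonzero eigenvalues of the periodic Laplacian are at least `4 sin² (π / N)`. -/
theorem spectral_gap (h : laplacian v = t • v) (hv : v ≠ 0) (ht : t ≠ 0) :
    4 * Real.sin (Real.pi / N) ^ 2 ≤ t := by
  obtain ⟨h0, h4⟩ := eigenvalue_mem_Icc h hv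
  obtain ⟨θ, hθ0, hθπ, rfl⟩ := exists_angle h0 h4
  have hN : (0 : ℝ) < N := Nat.cast_pos.2 (NeZero.pos N)
  obtain ⟨ℓ, hℓ⟩ : ∃ ℓ, v ℓ ≠ 0 := by
    by_contra! hc
    exact hv (by ext ℓ; simpa using hc ℓ)
  -- A shift by N is the identity, so 2 v ℓ = 2 cos(Nθ) v ℓ. Thus θ is a multiple of 2π/N, and t ≠ 0
  -- forces θ ≥ 2π/N.
  have hcos : Real.cos (N * θ) = 1 := by
    have := shift_add_shift h N ℓ
    simp only [ZMod.natCast_self, add_zero, sub_zero] at this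
    exact mul_right_cancel₀ hℓ (by linarith)
  obtain ⟨k, hk⟩ := (Real.cos_eq_one_iff _).1 hcos
  have hθ : 0 < θ := by
    refine hθ0.lt_of_ne' fun h' => ht ?_
    simp [h']
  have hk1 : (1 : ℝ) ≤ k := by
    have hpos : 0 < (k : ℝ) * (2 * Real.pi) := by rw [hk]; positivity
    have : (0 : ℝ) < k := pos_of_mul_pos_left hpos (by positivity)
    exact_mod_cast this
  have hle : 2 * (Real.pi / N) ≤ θ := by
    rw [← mul_div_assoc, div_le_iff₀ hN]
    nlinarith [Real.pi_pos]
  have := Real.cos_le_cos_of_nonneg_of_le_pi (by positivity) hθπ hle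
  rw [Real.cos_two_mul, Real.cos_sq'] at this
  linarith

theorem atomisticOp_apply_eigenvector (φ : ℝ → ℝ) (R : ℕ) (F : ℝ) (h : laplacian v = t • v) (hv : v ≠ 0) :
    atomisticOp φ R F v = (elasticSum φ R F * t + diffSymbol φ R F t * t ^ 2) • v := by
  obtain ⟨h0, h4⟩ := eigenvalue_mem_Icc h hv
  obtain ⟨θ, -, -, rfl⟩ := exists_angle h0 h4
  ext ℓ
  change ∑ r ∈ Icc 1 R, coeff φ F r * (-v (ℓ + (r : ZMod N)) + 2 * v ℓ - v (ℓ - (r : ZMod N))) =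
    (elasticSum φ R F * _ + diffSymbol φ R F _ * _) * v ℓ
  rw [elasticSum, diffSymbol, Finset.sum_mul, Finset.sum_mul, ← Finset.sum_add_distrib,
    Finset.sum_mul]
  refine Finset.sum_congr rfl fun r _ => ?_
  linear_combination (-coeff φ F r) * shift_add_shift h r ℓ -
    coeff φ F r * v ℓ * sq_mul_remainderQuotient θ r

end Eigenvector

/-! ### The mean-zero projection and the compressed indicator -/

theorem indicatorOp_isSymmetric (A : Finset (ZMod N)) : (indicatorOp A).IsSymmetric := fun u v => by
  rw [inner_per, inner_per]
  refine Finset.sum_congr rfl fun ℓ _ => ?_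
  by_cases h : ℓ ∈ A <;> simp [indicatorOp_apply, h]

theorem meanZeroProj_isSymmetric : (meanZeroProj (N := N)).IsSymmetric := fun u v => by
  rw [inner_per, inner_per]
  simp only [meanZeroProj_apply, sub_mul, mul_sub, Finset.sum_sub_distrib, ← Finset.mul_sum,
    ← Finset.sum_mul]
  ring

theorem meanZeroProj_of_sum_eq_zero {u : Per N} (h : ∑ ℓ, u ℓ = 0) : meanZeroProj u = u := by
  ext ℓ
  rw [meanZeroProj_apply, h, mul_zero, sub_zero]

theorem sum_meanZeroProj (u : Per N) : ∑ ℓ, meanZeroProj u ℓ = 0 := by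
  have hN : (N : ℝ) ≠ 0 := NeZero.ne _
  simp only [meanZeroProj_apply, Finset.sum_sub_distrib, Finset.sum_const, Finset.card_univ,
    ZMod.card, nsmul_eq_mul]
  field_simp
  ring

theorem meanZeroProj_idem (u : Per N) : meanZeroProj (meanZeroProj u) = meanZeroProj u :=
  meanZeroProj_of_sum_eq_zero (sum_meanZeroProj u)

theorem meanZeroProj_laplacian (u : Per N) : meanZeroProj (laplacian u) = laplacian u := by
  refine meanZeroProj_of_sum_eq_zero ?_
  have h1 := sum_shift (fun ℓ => u ℓ) 1
  have h2 := sum_shift_sub (fun ℓ => u ℓ) 1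
  simp only [laplacian_apply, Finset.sum_sub_distrib, Finset.sum_add_distrib,
    Finset.sum_neg_distrib, ← Finset.mul_sum]
  rw [h1, h2]
  ring

theorem meanZeroProj_of_laplacian_eq_zero {u : Per N} (h : laplacian u = 0) :
    meanZeroProj u = 0 := by
  have hN : (N : ℝ) ≠ 0 := NeZero.ne _
  ext ℓ
  rw [meanZeroProj_apply, Finset.sum_congr rfl fun k _ => eq_const_of_laplacian_eq_zero h k,
    eq_const_of_laplacian_eq_zero h ℓ]
  simp [ZMod.card, hN]

/-- The compression of the indicator of `A` to the mean-zero sequences. -/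
noncomputable def compression (A : Finset (ZMod N)) : Per N →ₗ[ℝ] Per N :=
  meanZeroProj ∘ₗ indicatorOp A ∘ₗ meanZeroProj

section Compression

variable (A : Finset (ZMod N))

theorem compression_isSymmetric : (compression A).IsSymmetric := fun u v => by
  simp only [compression, LinearMap.comp_apply]
  rw [meanZeroProj_isSymmetric, indicatorOp_isSymmetric, meanZeroProj_isSymmetric]

theorem inner_compression (v : Per N) :
    inner ℝ (compression A v) v = ‖indicatorOp A (meanZeroProj v)‖ ^ 2 := by
  simp only [compression, LinearMap.comp_apply]
  rw [meanZeroProj_isSymmetric,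
    inner_apply_eq_norm_sq (indicatorOp_isSymmetric A) (indicatorOp_idem A)]

theorem norm_indicatorOp_meanZeroProj_le (v : Per N) :
    ‖indicatorOp A (meanZeroProj v)‖ ≤ ‖v‖ :=
  (norm_apply_le (indicatorOp_isSymmetric A) (indicatorOp_idem A) _).trans
    (norm_apply_le meanZeroProj_isSymmetric meanZeroProj_idem v)

theorem inner_compression_nonneg (v : Per N) : 0 ≤ inner ℝ (compression A v) v := by
  rw [inner_compression]; positivity

theorem inner_compression_le (v : Per N) : inner ℝ (compression A v) v ≤ ‖v‖ ^ 2 := by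
  rw [inner_compression]
  exact pow_le_pow_left₀ (norm_nonneg _) (norm_indicatorOp_meanZeroProj_le A v) 2

theorem norm_compression_le (v : Per N) : ‖compression A v‖ ≤ ‖v‖ :=
  (norm_apply_le meanZeroProj_isSymmetric meanZeroProj_idem
    (indicatorOp A (meanZeroProj v))).trans (norm_indicatorOp_meanZeroProj_le A v)

/-- In an eigenbasis of the Laplacian the projected QCF operator is a `forceOp`. -/
theorem qcfOp₀_eq_forceOp (φ : ℝ → ℝ) (R : ℕ) (F : ℝ) {ι : Type*} [Fintype ι]
    (b : OrthonormalBasis ι ℝ (Per N)) {t : ι → ℝ} (hb : ∀ i, laplacian (b i) = t i • b i) :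
    qcfOp₀ φ R F A =
      forceOp b (elasticSum φ R F) t (fun i => diffSymbol φ R F (t i)) (compression A) := by
  refine b.toBasis.ext fun i => ?_
  have hv : b i ≠ 0 := b.orthonormal.ne_zero i
  rw [OrthonormalBasis.coe_toBasis]
  -- `b i` is mean-zero unless `t i` = 0. Keeping one factor `t i` attached therefore allows P to be
  -- inserted before the indicator in every case.
  have hP : t i • meanZeroProj (b i) = t i • b i := by
    rw [← map_smul, ← hb, meanZeroProj_laplacian]
  have hq : qcfOp φ R F A (b i) = elasticSum φ R F • t i • b i +
      (diffSymbol φ R F (t i) * t i) • t i • indicatorOp A (b i) := by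
    ext ℓ
    change (if ℓ ∈ A then atomisticOp φ R F (b i) ℓ else continuumOp φ R F (b i) ℓ) = _
    rw [atomisticOp_apply_eigenvector φ R F (hb i) hv, continuumOp_eq, LinearMap.smul_apply, hb]
    simp only [PiLp.add_apply, PiLp.smul_apply, smul_eq_mul, indicatorOp_apply]
    by_cases h : ℓ ∈ A
    · simp only [h, if_true]; ring
    · simp only [h, if_false]; ring
  rw [qcfOp₀, LinearMap.comp_apply, hq]
  simp only [forceOp, compression, LinearMap.add_apply, LinearMap.smul_apply,
    LinearMap.comp_apply, basisDiag_basis, map_add, map_smul, hP]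
  congr 1
  rw [smul_smul, sq, ← mul_assoc, ← smul_smul (_ * _), ← smul_smul (_ * _),
    ← map_smul meanZeroProj (t i), ← map_smul (indicatorOp A) (t i), ← hP, map_smul, map_smul]

end Compression

/-! ### The Cauchy–Born modulus as a coefficient sum -/

section Modulus

variable {φ : ℝ → ℝ} {F : ℝ}

theorem iteratedDeriv_two_comp_mul_left (φ : ℝ → ℝ) (c x : ℝ) :
    iteratedDeriv 2 (fun s => φ (c * s)) x = c ^ 2 * iteratedDeriv 2 φ (c * x) := by
  have h1 : deriv (fun s => φ (c * s)) = fun s => c * deriv φ (c * s) := by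
    funext s
    rw [deriv_comp_mul_left, smul_eq_mul]
  rw [iteratedDeriv_succ, iteratedDeriv_one, h1, deriv_const_mul_field, deriv_comp_mul_left,
    iteratedDeriv_succ, iteratedDeriv_one, smul_eq_mul]
  ring

theorem contDiffAt_comp_mul_left (hφ : ContDiffOn ℝ 2 φ (Set.Ioi 0)) (hF : 0 < F) {r : ℕ}
    (hr : 1 ≤ r) : ContDiffAt ℝ 2 (fun s => φ ((r : ℝ) * s)) F := by
  have hpos : 0 < (r : ℝ) * F := mul_pos (by exact_mod_cast hr) hF
  have h1 : ContDiffAt ℝ 2 φ ((r : ℝ) * F) := hφ.contDiffAt (Ioi_mem_nhds hpos)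
  exact h1.comp F (contDiffAt_const.mul contDiffAt_id)

theorem modulus_eq (hφ : ContDiffOn ℝ 2 φ (Set.Ioi 0)) (hF : 0 < F) (R : ℕ) :
    modulus φ R F = elasticSum φ R F := by
  -- Differentiability is carried through the induction because additivity of the second derivative
  -- requires it of both summands.
  have key : ∀ n : ℕ, ContDiffAt ℝ 2 (cauchyBorn φ n) F ∧
      iteratedDeriv 2 (cauchyBorn φ n) F = elasticSum φ n F := by
    intro n
    induction n with
    | zero =>
      have : cauchyBorn φ 0 = fun _ => 0 := by funext s; simp [cauchyBorn]
      rw [this]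
      exact ⟨contDiffAt_const, by simp [elasticSum]⟩
    | succ n ih =>
      have h := contDiffAt_comp_mul_left hφ hF (Nat.le_add_left 1 n)
      have e : cauchyBorn φ (n + 1) =
          cauchyBorn φ n + fun s => φ (((n + 1 : ℕ) : ℝ) * s) := by
        funext s
        simp only [cauchyBorn, Pi.add_apply]
        exact Finset.sum_Icc_succ_top (Nat.le_add_left 1 n) _
      refine ⟨e ▸ ih.1.add h, ?_⟩
      rw [e, iteratedDeriv_add ih.1 h, ih.2, iteratedDeriv_two_comp_mul_left, elasticSum,
        elasticSum, Finset.sum_Icc_succ_top (Nat.le_add_left 1 n), coeff, mul_comm]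
  exact (key R).2

end Modulus

/-! ### Ordered eigenvalues and diagonalization -/

variable {N : ℕ}

theorem diagOp_apply (μ : Fin N → ℝ) (x : EuclideanSpace ℝ (Fin N)) (j : Fin N) :
    diagOp μ x j = μ j * x j := by
  simp [diagOp, Matrix.mulVec_diagonal]

theorem charpoly_diagOp (μ : Fin N → ℝ) : (diagOp μ).charpoly = ∏ j, (X - C (μ j)) := by
  rw [← Matrix.charpoly_diagonal, ← LinearMap.charpoly_toMatrix _ (PiLp.basisFun 2 ℝ (Fin N))]
  congr 1
  ext i j
  simp [LinearMap.toMatrix_apply, diagOp_apply, Matrix.diagonal_apply]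

variable [NeZero N]

theorem finrank_per : Module.finrank ℝ (Per N) = N := by
  simp [ZMod.card]

theorem isOrderedEigenvalues_of_conj {L : Per N →ₗ[ℝ] Per N} {μ : Fin N → ℝ} (hμ : Monotone μ)
    (V : EuclideanSpace ℝ (Fin N) ≃ₗ[ℝ] Per N) (h : ∀ x, L (V x) = V (diagOp μ x)) :
    IsOrderedEigenvalues L μ := by
  refine ⟨hμ, ?_⟩
  rw [← charpoly_diagOp, ← V.charpoly_conj (diagOp μ)]
  congr 1
  ext1 u
  rw [LinearEquiv.conj_apply_apply, ← h, LinearEquiv.apply_symm_apply]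

theorem apply_repr_symm {S : Per N →ₗ[ℝ] Per N} {μ : Fin N → ℝ}
    (q : OrthonormalBasis (Fin N) ℝ (Per N)) (h : ∀ j, S (q j) = μ j • q j)
    (x : EuclideanSpace ℝ (Fin N)) : S (q.repr.symm x) = q.repr.symm (diagOp μ x) := by
  rw [← q.sum_repr_symm, ← q.sum_repr_symm, map_sum]
  refine Finset.sum_congr rfl fun j _ => ?_
  rw [map_smul, h, smul_smul, diagOp_apply, mul_comm]

theorem exists_ordered_eigenbasis {S : Per N →ₗ[ℝ] Per N} (hS : S.IsSymmetric) :
    ∃ (q : OrthonormalBasis (Fin N) ℝ (Per N)) (ev : Fin N → ℝ), Monotone ev ∧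
      ∀ j, S (q j) = ev j • q j :=
  exists_monotone_eigenbasis finrank_per hS

theorem isOrderedEigenvalues_of_eigenbasis {S : Per N →ₗ[ℝ] Per N} {μ : Fin N → ℝ}
    (hμ : Monotone μ) (q : OrthonormalBasis (Fin N) ℝ (Per N))
    (h : ∀ j, S (q j) = μ j • q j) : IsOrderedEigenvalues S μ :=
  isOrderedEigenvalues_of_conj hμ q.repr.symm.toLinearEquiv (apply_repr_symm q h)

theorem sum_fin_eq_sum_Icc (R : ℕ) (f : ℕ → ℝ) :
    ∑ i : Fin R, f (i.val + 1) = ∑ r ∈ Icc 1 R, f r := by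
  rw [Fin.sum_univ_eq_sum_range (fun i => f (i + 1)), Finset.range_eq_Ico,
    Finset.sum_Ico_add' f 0 R 1]
  rfl

/-- The bound on the condition number in terms of the coefficients `c i = φ''_{(i+1)F}`. -/
noncomputable def condBound (R : ℕ) (c : Fin R → ℝ) : ℝ :=
  let w := ∑ i : Fin R, c i * ((i.val + 1 : ℕ) : ℝ) ^ 2
  let g := ∑ i : Fin R, |c i| * ((i.val + 1 : ℕ) : ℝ) ^ 2
  -- The sum selects the single term -φ''_{RF}; writing it this way avoids an index into `Fin R`,
  -- which may be empty here.
  let α := ∑ i : Fin R, if i.val + 1 = R then -c i else 0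
  let β := ∑ i : Fin R, |c i| * ((i.val + 1 : ℕ) : ℝ) ^ 4
  (w + g) / √α * ((w + g) / w ^ 2 * √β)

/-! ### Bounds on the symbols -/

section Bounds

variable {φ : ℝ → ℝ} {R : ℕ} {F t : ℝ}

/-- All summands are nonnegative: the r = 1 term vanishes whatever the sign of its coefficient, and
the others have -φ''_{rF} ≥ 0. Keeping only r = R, where q_R ≥ 1, suffices. -/
theorem le_diffSymbol (hR : 2 ≤ R) (hc : ∀ r : ℕ, 2 ≤ r → r ≤ R → coeff φ F r ≤ 0)
    (h0 : 0 ≤ t) (h4 : t ≤ 4) : -coeff φ F R ≤ diffSymbol φ R F t := by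
  have h1 : -coeff φ F R * remainderQuotient t R ≤ diffSymbol φ R F t := by
    refine Finset.single_le_sum (f := fun r => -coeff φ F r * remainderQuotient t r)
      (fun r hr => ?_) (Finset.mem_Icc.2 ⟨by omega, le_rfl⟩)
    obtain ⟨hr1, hrR⟩ := Finset.mem_Icc.1 hr
    rcases hr1.eq_or_lt with h | h
    · simp [← h, remainderQuotient]
    · exact mul_nonneg (neg_nonneg.2 (hc r h hrR)) (remainderQuotient_nonneg h0 h4 r)
  exact (le_mul_of_one_le_right (neg_nonneg.2 (hc R hR le_rfl))
    (one_le_remainderQuotient h0 h4 hR)).trans h1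

theorem diffSymbol_le (h0 : 0 ≤ t) (h4 : t ≤ 4) :
    diffSymbol φ R F t ≤ ∑ r ∈ Icc 1 R, |coeff φ F r| * (r : ℝ) ^ 4 :=
  Finset.sum_le_sum fun r _ => mul_le_mul (neg_le_abs _) (remainderQuotient_le h0 h4 r)
    (remainderQuotient_nonneg h0 h4 r) (abs_nonneg _)

theorem diffSymbol_mul_le (h0 : 0 ≤ t) (h4 : t ≤ 4) :
    diffSymbol φ R F t * t ≤ ∑ r ∈ Icc 1 R, |coeff φ F r| * (r : ℝ) ^ 2 := by
  rw [diffSymbol, Finset.sum_mul]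
  refine Finset.sum_le_sum fun r _ => ?_
  rw [mul_assoc, mul_comm _ t]
  exact mul_le_mul (neg_le_abs _) (mul_remainderQuotient_le h0 h4 r)
    (mul_nonneg h0 (remainderQuotient_nonneg h0 h4 r)) (abs_nonneg _)

/-- The symbol of the atomistic operator is at most `4 φ''_F`. -/
theorem atomistic_symbol_le (hR : 2 ≤ R) (hc : ∀ r : ℕ, 2 ≤ r → r ≤ R → coeff φ F r ≤ 0)
    (hw : 0 < elasticSum φ R F) (h0 : 0 ≤ t) (h4 : t ≤ 4) :
    elasticSum φ R F * t + diffSymbol φ R F t * t ^ 2 ≤ 4 * coeff φ F 1 := by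
  have h1R : (1 : ℕ) ∈ Icc 1 R := Finset.mem_Icc.2 ⟨le_rfl, by omega⟩
  have hmem : ∀ r ∈ (Icc 1 R).erase 1, coeff φ F r ≤ 0 := fun r hr => by
    simp only [Finset.mem_erase, Finset.mem_Icc] at hr
    exact hc r (by omega) hr.2.2
  have hc1 : 0 ≤ coeff φ F 1 := by
    rw [elasticSum, ← Finset.add_sum_erase _ _ h1R] at hw
    have : ∑ r ∈ (Icc 1 R).erase 1, coeff φ F r * (r : ℝ) ^ 2 ≤ 0 :=
      Finset.sum_nonpos fun r hr => mul_nonpos_of_nonpos_of_nonneg (hmem r hr) (sq_nonneg _)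
    simp only [Nat.cast_one, one_pow, mul_one] at hw
    linarith
  -- Each summand is φ''_{rF}(2 - 2 cos(rθ)) in disguise; those with r ≥ 2 are nonpositive and the r
  -- = 1 term is φ''_F t.
  have hsum : elasticSum φ R F * t + diffSymbol φ R F t * t ^ 2 =
      ∑ r ∈ Icc 1 R, coeff φ F r * (t * ((r : ℝ) ^ 2 - t * remainderQuotient t r)) := by
    rw [elasticSum, diffSymbol, Finset.sum_mul, Finset.sum_mul, ← Finset.sum_add_distrib]
    exact Finset.sum_congr rfl fun r _ => by ring
  rw [hsum, ← Finset.add_sum_erase _ _ h1R]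
  have : ∑ r ∈ (Icc 1 R).erase 1,
      coeff φ F r * (t * ((r : ℝ) ^ 2 - t * remainderQuotient t r)) ≤ 0 :=
    Finset.sum_nonpos fun r hr => mul_nonpos_of_nonpos_of_nonneg (hmem r hr)
      (mul_nonneg h0 (sub_nonneg.2 (mul_remainderQuotient_le h0 h4 r)))
  simp only [remainderQuotient, Nat.cast_one, one_pow, mul_zero, sub_zero, mul_one] at this ⊢
  nlinarith

end Bounds

/-! ### Condition number and extreme eigenvalues -/

/-- The composition of the coordinate isometry of `q` and `M`. -/
noncomputable def diagonalizer (q : OrthonormalBasis (Fin N) ℝ (Per N)) (M : Per N ≃ₗ[ℝ] Per N) :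
    EuclideanSpace ℝ (Fin N) ≃L[ℝ] Per N :=
  (q.repr.symm.toLinearEquiv.trans M).toContinuousLinearEquiv

theorem apply_diagonalizer {L S : Per N →ₗ[ℝ] Per N} {μ : Fin N → ℝ}
    (q : OrthonormalBasis (Fin N) ℝ (Per N)) (hq : ∀ j, S (q j) = μ j • q j)
    (M : Per N ≃ₗ[ℝ] Per N) (hM : ∀ u, L (M u) = M (S u)) (y : EuclideanSpace ℝ (Fin N)) :
    L (diagonalizer q M y) = diagonalizer q M (diagOp μ y) :=
  (hM _).trans (congrArg M (apply_repr_symm q hq y))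

/-- The condition number of the composition of an isometry and `M`. -/
theorem cond_le (q : OrthonormalBasis (Fin N) ℝ (Per N)) (M : Per N ≃ₗ[ℝ] Per N) {a b : ℝ}
    (ha : 0 ≤ a) (hb : 0 ≤ b) (h1 : ∀ u, ‖M u‖ ≤ a * ‖u‖) (h2 : ∀ u, ‖u‖ ≤ b * ‖M u‖) :
    cond (diagonalizer q M) ≤ a * b := by
  refine mul_le_mul (ContinuousLinearMap.opNorm_le_bound _ ha fun x => ?_)
    (ContinuousLinearMap.opNorm_le_bound _ hb fun u => ?_) (norm_nonneg _) ha
  · refine (h1 (q.repr.symm x)).trans (le_of_eq ?_)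
    rw [LinearIsometryEquiv.norm_map]
  · have := h2 (M.symm u)
    rw [LinearEquiv.apply_symm_apply] at this
    refine le_trans (le_of_eq ?_) this
    exact q.repr.norm_map (M.symm u)

/-- The second and higher eigenvalues of a positive multiple of the Laplacian. -/
theorem laplacian_eigenvalue_ge {w : ℝ} (hw : 0 < w) {μ : Fin N → ℝ} (hμ : Monotone μ)
    (q : OrthonormalBasis (Fin N) ℝ (Per N)) (h : ∀ j, (w • laplacian) (q j) = μ j • q j)
    {j : Fin N} (hj : j ≠ 0) : 4 * w * Real.sin (Real.pi / N) ^ 2 ≤ μ j := by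
  have h1 : ∀ i, laplacian (q i) = (μ i / w) • q i := fun i => by
    have := congrArg (fun u => w⁻¹ • u) (h i)
    simpa [smul_smul, hw.ne', div_eq_inv_mul] using this
  have hq : ∀ i, q i ≠ 0 := fun i => q.orthonormal.ne_zero i
  have hnn : ∀ i, 0 ≤ μ i := fun i => by
    have := (eigenvalue_mem_Icc (h1 i) (hq i)).1
    rwa [le_div_iff₀ hw, zero_mul] at this
  -- Otherwise `q 0` and `q j` would both be constant, and two nonzero constants are not orthogonal.
  have hne : μ j ≠ 0 := fun h0 => by
    have h00 : μ 0 = 0 := le_antisymm (h0 ▸ hμ (Fin.zero_le j)) (hnn 0)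
    have e0 : laplacian (q 0) = 0 := by rw [h1, h00]; simp
    have ej : laplacian (q j) = 0 := by rw [h1, h0]; simp
    have c0 := eq_const_of_laplacian_eq_zero e0
    have cj := eq_const_of_laplacian_eq_zero ej
    have horth : inner ℝ (q j) (q 0) = 0 := q.orthonormal.2 hj
    rw [inner_per, Finset.sum_congr rfl fun ℓ _ => by rw [c0 ℓ, cj ℓ], Finset.sum_const,
      Finset.card_univ, ZMod.card, nsmul_eq_mul] at horth
    rcases mul_eq_zero.1 horth with hN | hz
    · exact NeZero.ne (N : ℝ) hN
    rcases mul_eq_zero.1 hz with hz | hz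
    · exact hq j (by ext ℓ; simp [cj ℓ, hz])
    · exact hq 0 (by ext ℓ; simp [c0 ℓ, hz])
  have := spectral_gap (h1 j) (hq j) (div_ne_zero hne hw.ne')
  rw [le_div_iff₀ hw] at this
  linarith

/-- The smallest eigenvalue of a positive semidefinite operator with a kernel vanishes. -/
theorem eigenvalue_zero_eq_zero {S : Per N →ₗ[ℝ] Per N} {μ : Fin N → ℝ} (hμ : Monotone μ)
    (q : OrthonormalBasis (Fin N) ℝ (Per N)) (h : ∀ j, S (q j) = μ j • q j)
    (hS : ∀ u, 0 ≤ inner ℝ (S u) u) {e : Per N} (he : e ≠ 0) (hSe : S e = 0) : μ 0 = 0 := by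
  have hnn : 0 ≤ μ 0 := by
    have := hS (q 0)
    rwa [h, real_inner_smul_left, real_inner_self_eq_norm_sq, q.orthonormal.1, one_pow,
      mul_one] at this
  refine le_antisymm ?_ hnn
  by_contra! hpos
  have h0 : ∑ j, μ j * inner ℝ (q j) e ^ 2 = 0 := by
    rw [← inner_apply_of_eigenbasis q h, hSe, inner_zero_left]
  refine he (ext_inner_basis q fun j => ?_)
  have hj := (Finset.sum_eq_zero_iff_of_nonneg fun j _ =>
    mul_nonneg (hnn.trans (hμ (Fin.zero_le j))) (sq_nonneg _)).1 h0 j (mem_univ _)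
  rw [inner_zero_right]
  exact pow_eq_zero_iff two_ne_zero |>.1
    ((mul_eq_zero.1 hj).resolve_left (hpos.trans_le (hμ (Fin.zero_le j))).ne')

end QCF

/-! ### Assembly of the main theorem -/

theorem theorem4p1 (R : ℕ) (hR : 2 ≤ R) :
    ∃ K : (Fin R → ℝ) → ℝ,
      ∀ (φ : ℝ → ℝ) (F : ℝ), ContDiffOn ℝ 2 φ (Set.Ioi 0) → 0 < F →
        (∀ r : ℕ, 2 ≤ r → r ≤ R → QCF.coeff φ F r ≤ 0) → QCF.coeff φ F R ≠ 0 →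
        ∀ (N : ℕ) [NeZero N] (A : Finset (ZMod N)),
          ∃ (V : EuclideanSpace ℝ (Fin N) ≃L[ℝ] QCF.Per N) (ev evc eva : Fin N → ℝ),
            QCF.IsOrderedEigenvalues (QCF.qcfOp₀ φ R F A) ev ∧
            QCF.IsOrderedEigenvalues (QCF.continuumOp (N := N) φ R F) evc ∧
            QCF.IsOrderedEigenvalues (QCF.atomisticOp (N := N) φ R F) eva ∧
            (∀ x, QCF.qcfOp₀ φ R F A (V x) = V (QCF.diagOp ev x)) ∧
            (0 < QCF.modulus φ R F →
              QCF.cond V ≤ K (fun r => QCF.coeff φ F (r.val + 1)) ∧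
              (∀ j, evc j ≤ ev j ∧ ev j ≤ eva j) ∧
              ev 0 = 0 ∧
              (∀ j, j ≠ 0 →
                4 * QCF.modulus φ R F * Real.sin (Real.pi / N) ^ 2 ≤ ev j ∧
                  ev j ≤ 4 * QCF.coeff φ F 1)) := by
  refine ⟨QCF.condBound R, fun φ F hφ hF hc hcR N _ A => ?_⟩
  rw [QCF.modulus_eq hφ hF]
  obtain ⟨b, t, -, hb⟩ := QCF.exists_ordered_eigenbasis
    (QCF.laplacian_isSymmetric (N := N))
  have hbne : ∀ i, b i ≠ 0 := fun i => b.orthonormal.ne_zero i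
  have ht0 : ∀ i, 0 ≤ t i := fun i => (QCF.eigenvalue_mem_Icc (hb i) (hbne i)).1
  have ht4 : ∀ i, t i ≤ 4 := fun i => (QCF.eigenvalue_mem_Icc (hb i) (hbne i)).2
  obtain ⟨w, hw⟩ : ∃ w, w = QCF.elasticSum φ R F := ⟨_, rfl⟩
  rw [← hw]
  set x : Fin N → ℝ := fun i => QCF.diffSymbol φ R F (t i) with hx
  have hα : 0 < -QCF.coeff φ F R := neg_pos.2 ((hc R hR le_rfl).lt_of_ne hcR)
  have hxα : ∀ i, -QCF.coeff φ F R ≤ x i := fun i => QCF.le_diffSymbol hR hc (ht0 i) (ht4 i)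
  have hxpos : ∀ i, 0 < x i := fun i => hα.trans_le (hxα i)
  have hlap : QCF.laplacian = QCF.basisDiag b t := QCF.eq_basisDiag b t hb
  have hcont : QCF.continuumOp φ R F = w • QCF.basisDiag b t := by
    rw [QCF.continuumOp_eq, hlap, hw]
  have hatom : QCF.atomisticOp φ R F = QCF.basisDiag b (fun i => w * t i + x i * t i ^ 2) :=
    QCF.eq_basisDiag b _ fun i => hw ▸ QCF.atomisticOp_apply_eigenvector φ R F (hb i) (hbne i)
  have hsymC : (QCF.continuumOp (N := N) φ R F).IsSymmetric := by
    rw [hcont]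
    exact (QCF.basisDiag_isSymmetric b t).smul (by simp)
  obtain ⟨p, evc, hevc, hp⟩ := QCF.exists_ordered_eigenbasis hsymC
  obtain ⟨p', eva, heva, hp'⟩ := QCF.exists_ordered_eigenbasis
    (show (QCF.atomisticOp (N := N) φ R F).IsSymmetric from
      hatom ▸ QCF.basisDiag_isSymmetric b _)
  obtain ⟨q, ev, hev, hq⟩ := QCF.exists_ordered_eigenbasis
    (QCF.symmOp_isSymmetric b w t x _ (QCF.compression_isSymmetric A))
  rw [show QCF.qcfOp₀ φ R F A = QCF.forceOp b w t x (QCF.compression A) from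
    hw ▸ QCF.qcfOp₀_eq_forceOp A φ R F b hb]
  have hordc := QCF.isOrderedEigenvalues_of_eigenbasis hevc p hp
  have horda := QCF.isOrderedEigenvalues_of_eigenbasis heva p' hp'
  -- Diagonalizability is claimed for every sign of w, while the quantitative conclusions need w >
  -- 0.
  rcases le_or_gt w 0 with hw0 | hw0
  · have hC : ∀ i, t i = 0 → QCF.compression A (b i) = 0 := fun i hi => by
      have h := QCF.meanZeroProj_of_laplacian_eq_zero (u := b i) (by rw [hb, hi, zero_smul])
      simp [QCF.compression, h]
    obtain ⟨M, hM⟩ := QCF.exists_similarity b w t x _ hxpos hC (QCF.compression_isSymmetric A)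
    exact ⟨QCF.diagonalizer q M, ev, evc, eva,
      QCF.isOrderedEigenvalues_of_conj hev (QCF.diagonalizer q M).toLinearEquiv
        (QCF.apply_diagonalizer q hq M hM), hordc, horda, QCF.apply_diagonalizer q hq M hM,
      fun h => absurd h hw0.not_gt⟩
  · obtain ⟨g, hg⟩ : ∃ g, g = ∑ r ∈ Icc 1 R, |QCF.coeff φ F r| * (r : ℝ) ^ 2 := ⟨_, rfl⟩
    obtain ⟨β, hβ⟩ : ∃ β, β = ∑ r ∈ Icc 1 R, |QCF.coeff φ F r| * (r : ℝ) ^ 4 := ⟨_, rfl⟩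
    have hg0 : 0 ≤ g := hg ▸ Finset.sum_nonneg fun r _ => by positivity
    obtain ⟨M, hM, hM1, hM2⟩ := QCF.exists_bounded_similarity b w t x (QCF.compression A)
      (β := β) hw0 hα hg0 hxα (fun i => hβ ▸ QCF.diffSymbol_le (ht0 i) (ht4 i)) ht0
      (fun i => hg ▸ QCF.diffSymbol_mul_le (ht0 i) (ht4 i)) (QCF.inner_compression_nonneg A)
      (QCF.norm_compression_le A)
    have hge : ∀ j, evc j ≤ ev j := QCF.eigenvalue_mono p q hevc hev hp hq fun u => by
      rw [hcont]
      exact QCF.inner_symmOp_ge b w t x _ (QCF.inner_compression_nonneg A) u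
    have hle : ∀ j, ev j ≤ eva j := QCF.eigenvalue_mono q p' hev heva hq hp' fun u => by
      rw [hatom]
      exact QCF.inner_symmOp_le b w t x _ (fun i => (hxpos i).le) (QCF.inner_compression_le A) u
    refine ⟨QCF.diagonalizer q M, ev, evc, eva,
      QCF.isOrderedEigenvalues_of_conj hev (QCF.diagonalizer q M).toLinearEquiv
        (QCF.apply_diagonalizer q hq M hM), hordc, horda, QCF.apply_diagonalizer q hq M hM, fun _ =>
      ⟨?_, fun j => ⟨hge j, hle j⟩, ?_, fun j hj => ⟨?_, (hle j).trans ?_⟩⟩⟩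
    · refine (QCF.cond_le q M (div_nonneg (add_nonneg hw0.le hg0) (Real.sqrt_nonneg _))
        (mul_nonneg (div_nonneg (add_nonneg hw0.le hg0) (sq_nonneg w)) (Real.sqrt_nonneg _))
        hM1 hM2).trans (le_of_eq ?_)
      have e1 := QCF.sum_fin_eq_sum_Icc R fun r => QCF.coeff φ F r * (r : ℝ) ^ 2
      have e2 := QCF.sum_fin_eq_sum_Icc R fun r => |QCF.coeff φ F r| * (r : ℝ) ^ 2
      have e3 := QCF.sum_fin_eq_sum_Icc R fun r => if r = R then -QCF.coeff φ F r else 0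
      have e4 := QCF.sum_fin_eq_sum_Icc R fun r => |QCF.coeff φ F r| * (r : ℝ) ^ 4
      rw [Finset.sum_ite_eq' (Icc 1 R) R, if_pos (Finset.mem_Icc.2 ⟨by omega, le_rfl⟩)] at e3
      simp only [QCF.condBound]
      rw [e1, e2, e3, e4, hg, hβ, hw, QCF.elasticSum]
    -- The constant sequence lies in ker L, hence in the kernel of the symmetrized operator.
    · have hone : (WithLp.toLp 2 fun _ => 1 : QCF.Per N) ≠ 0 := fun h => by
        simpa using congrArg (fun u : QCF.Per N => u 0) h
      have hl : QCF.laplacian (WithLp.toLp 2 fun _ => 1 : QCF.Per N) = 0 := by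
        ext ℓ
        rw [QCF.laplacian_apply]
        norm_num
      refine QCF.eigenvalue_zero_eq_zero hev q hq (fun u => ?_) hone
        (QCF.symmOp_apply_eq_zero b w t x _ (hlap ▸ hl))
      rw [QCF.inner_symmOp, ← hlap, QCF.inner_laplacian]
      exact add_nonneg (mul_nonneg hw0.le (Finset.sum_nonneg fun _ _ => mul_self_nonneg _))
        (QCF.inner_compression_nonneg A _)
    · exact (QCF.laplacian_eigenvalue_ge hw0 hevc p (fun j => by
        rw [← hp j, QCF.continuumOp_eq, hw]) hj).trans (hge j)
    -- The largest atomistic eigenvalues are bounded by the Rayleigh quotient of a unit eigenvector,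
    -- expanded in the Laplacian basis where the symbol bound applies termwise.
    · have h1 : inner ℝ (QCF.atomisticOp φ R F (p' j)) (p' j) ≤ 4 * QCF.coeff φ F 1 := by
        rw [hatom, QCF.inner_apply_of_eigenbasis b (QCF.basisDiag_basis b _)]
        calc _ ≤ ∑ i, 4 * QCF.coeff φ F 1 * inner ℝ (b i) (p' j) ^ 2 :=
              Finset.sum_le_sum fun i _ => mul_le_mul_of_nonneg_right
                (hw ▸ QCF.atomistic_symbol_le hR hc (hw ▸ hw0) (ht0 i) (ht4 i)) (sq_nonneg _)
          _ = _ := by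
              rw [← Finset.mul_sum, ← QCF.norm_sq_eq_sum, p'.orthonormal.1, one_pow, mul_one]
      rwa [hp', real_inner_smul_left, real_inner_self_eq_norm_sq, p'.orthonormal.1, one_pow,
        mul_one] at h1
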